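/- **Setting.** Fix a polynomially bounded o-minimal expansion of the real ordered field, and let $\mathbb K$ be a Hardy field consisting of germs at $+\infty$ of functions $\mathbb R\to\mathbb R$ definable (with parameters) in it, such that $\mathbb K$ contains the germ of $t\mapsto t^r$ for every $r\in\mathbb R$. For $f\in\mathbb K$ put $\operatorname{val} f=\lim_{t\to\infty}\frac{\log|f(t)|}{\log t}\in\mathbb T:=\mathbb R\cup\{-\infty\}$, with $\log 0=-\infty$. Let $A=(a_{ij})\in\mathbb T^{d\times m}$. A *lift* of $A$ is a matrix $\mathbf A=(\mathbf a_{ij})\in\mathbb K^{d\times m}$ whose entries are non-negative (as germs) and satisfy $\operatorname{val}\mathbf a_{ij}=a_{ij}$ for all $i,j$. Write $\operatorname{conv}\mathbf A(t)\subset\mathbb R^d$ for the convex hull of the columns of $\mathbf A(t)$, and $\operatorname{vol}\mathbf A$ for the germ of $t\mapsto\operatorname{vol}\operatorname{conv}\mathbf A(t)$, the $d$-dimensional Lebesgue volume. The upper and lower dequantized volumes of $A$ are $$\operatorname{qvol}^+A=\sup\{\operatorname{val}\operatorname{vol}\mathbf A\mid \mathbf A\text{ a lift of }A\},\qquad \operatorname{qvol}^-A=\inf\{\operatorname{val}\operatorname{vol}\mathbf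 A\mid \mathbf A\text{ a lift of }A\}.$$ A matrix $C$ over $\mathbb T$ is *tropically sign-generic* if for every maximal square submatrix $(c_{ij})_{1\le i,j\le k}$ of $C$, all optimal permutations have the same parity; here $\sigma$ is optimal if $\sum_i c_{i\sigma(i)}\neq-\infty$ and $\sigma$ maximizes $\sum_i c_{i\sigma(i)}$ over all permutations of $\{1,\dots,k\}$. Let $\bar A\in\mathbb T^{(d+1)\times m}$ be $A$ with a row of zeros (the real number $0$) added on top. **Theorem-Definition (Dequantized tropical volume).** If $\bar A$ is tropically sign-generic, then $\operatorname{qvol}^+A=\operatorname{qvol}^-A$. This common value, an element of $\mathbb R\cup\{-\infty\}$, is denoted $\operatorname{qvol}A$ and called the dequantized tropical volume of $A$. Moreover, for every lift $\mathbf A$ of $A$, $$\lim_{t\to\infty}\frac{\log\operatorname{vol}\operatorname{conv}\mathbf A(t)}{\log t}=\operatorname{qvol}A .$$ -/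

import Mathlib

open Filter Topology MeasureTheory

universe u v

namespace DequantizedVolume

/-! ### Hardy fields of functions definable in a polynomially bounded o-minimal structure -/

/-- A function `f : ℝ → ℝ` is definable (with real parameters) in the `L`-structure on `ℝ`
if its graph is. -/
def DefinableFun (L : FirstOrder.Language.{u, v}) [L.Structure ℝ] (f : ℝ → ℝ) : Prop :=
  (Set.univ : Set ℝ).Definable L {x : Fin 2 → ℝ | f (x 0) = x 1}

/-- The `L`-structure on `ℝ` is an o-minimal expansion of the ordered field of real numbers:
the order and the field operations are definable, and every subset of `ℝ` definable with
parameters is a finite union of intervals (points, bounded or unbounded intervals). -/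
structure IsOMinimal (L : FirstOrder.Language.{u, v}) [L.Structure ℝ] : Prop where
  definable_lt : (Set.univ : Set ℝ).Definable L {x : Fin 2 → ℝ | x 0 < x 1}
  definable_add : (Set.univ : Set ℝ).Definable L {x : Fin 3 → ℝ | x 0 + x 1 = x 2}
  definable_mul : (Set.univ : Set ℝ).Definable L {x : Fin 3 → ℝ | x 0 * x 1 = x 2}
  finite_union : ∀ s : Set ℝ, (Set.univ : Set ℝ).Definable₁ L s →
    ∃ S : Set (Set ℝ), S.Finite ∧ (∀ I ∈ S, I.OrdConnected) ∧ s = ⋃₀ S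

/-- Every definable function of one variable is eventually bounded by a power of `t`. -/
def IsPolynomiallyBounded (L : FirstOrder.Language.{u, v}) [L.Structure ℝ] : Prop :=
  ∀ f : ℝ → ℝ, DefinableFun L f → ∃ N : ℕ, ∀ᶠ t in atTop, |f t| ≤ t ^ N

/-- A Hardy field: a ring of germs at `+∞` of real functions that is a field and is closed
under differentiation. -/
structure IsHardyField (K : Subring (Germ (atTop : Filter ℝ) ℝ)) : Prop where
  exists_inv : ∀ φ ∈ K, φ ≠ 0 → ∃ ψ ∈ K, φ * ψ = 1
  deriv_mem : ∀ f : ℝ → ℝ, (f : Germ (atTop : Filter ℝ) ℝ) ∈ K →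
    (∀ᶠ t in atTop, DifferentiableAt ℝ f t) ∧ (deriv f : Germ (atTop : Filter ℝ) ℝ) ∈ K

/-- `K` is a Hardy field of germs of functions definable in the `L`-structure on `ℝ`, and it
contains the germs of all the power functions `t ↦ t ^ r`, `r ∈ ℝ`. -/
structure IsDefinableHardyField (L : FirstOrder.Language.{u, v}) [L.Structure ℝ]
    (K : Subring (Germ (atTop : Filter ℝ) ℝ)) : Prop where
  isHardyField : IsHardyField K
  definable : ∀ φ ∈ K, ∃ f : ℝ → ℝ, DefinableFun L f ∧ (f : Germ (atTop : Filter ℝ) ℝ) = φ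
  rpow_mem : ∀ r : ℝ, ((fun t : ℝ => t ^ r : ℝ → ℝ) : Germ (atTop : Filter ℝ) ℝ) ∈ K

/-! ### Tropical numbers and the valuation -/

/-- The ground set `ℝ ∪ {-∞}` of the max-plus semifield. Its tropical product is `+`. -/
abbrev Trop : Type := WithBot ℝ

/-- The inclusion of `ℝ ∪ {-∞}` into `[-∞, ∞]`, where limits and suprema are taken. -/
noncomputable def Trop.toEReal : Trop → EReal
  | none => ⊥
  | some x => ((x : ℝ) : EReal)

/-- `log |x| ∈ [-∞, ∞)`, with `log 0 = -∞`. -/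
noncomputable def logAbs (x : ℝ) : EReal := ENNReal.log (ENNReal.ofReal |x|)

/-- `val f = a`, that is, `lim_{t → ∞} log |f t| / log t = a` in `[-∞, ∞]`. -/
def HasVal (f : ℝ → ℝ) (a : EReal) : Prop :=
  Tendsto (fun t : ℝ => logAbs (f t) / ((Real.log t : ℝ) : EReal)) atTop (𝓝 a)

/-! ### Volumes -/

/-- The `d`-dimensional Lebesgue volume of the convex hull of the columns of `B`. -/
noncomputable def volConv {d m : ℕ} (B : Matrix (Fin d) (Fin m) ℝ) : ℝ :=
  (volume : Measure (Fin d → ℝ)).real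
    (convexHull ℝ (Set.range fun (j : Fin m) (i : Fin d) => B i j))

/-- `F : t ↦ F t` represents a matrix over `K_{≥ 0}` with entrywise valuation `A`. -/
structure IsLift (K : Subring (Germ (atTop : Filter ℝ) ℝ)) {d m : ℕ}
    (F : ℝ → Matrix (Fin d) (Fin m) ℝ) (A : Matrix (Fin d) (Fin m) Trop) : Prop where
  mem : ∀ i j, ((fun t : ℝ => F t i j : ℝ → ℝ) : Germ (atTop : Filter ℝ) ℝ) ∈ K
  nonneg : ∀ i j, ∀ᶠ t in atTop, 0 ≤ F t i j
  hasVal : ∀ i j, HasVal (fun t => F t i j) (A i j).toEReal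

/-- The valuations of the volumes of the lifts of `A`. The volume over `K` of the polytope
generated by the columns of a lift `F` is the germ of `t ↦ vol conv F(t)`. -/
def liftVolumeVals (K : Subring (Germ (atTop : Filter ℝ) ℝ)) {d m : ℕ}
    (A : Matrix (Fin d) (Fin m) Trop) : Set EReal :=
  {a | ∃ F : ℝ → Matrix (Fin d) (Fin m) ℝ, IsLift K F A ∧ HasVal (fun t => volConv (F t)) a}

/-- The upper dequantized tropical volume. -/
noncomputable def qvolUpper (K : Subring (Germ (atTop : Filter ℝ) ℝ)) {d m : ℕ}
    (A : Matrix (Fin d) (Fin m) Trop) : EReal :=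
  sSup (liftVolumeVals K A)

/-- The lower dequantized tropical volume. -/
noncomputable def qvolLower (K : Subring (Germ (atTop : Filter ℝ) ℝ)) {d m : ℕ}
    (A : Matrix (Fin d) (Fin m) Trop) : EReal :=
  sInf (liftVolumeVals K A)

/-! ### Sign-genericity -/

/-- `A` with an additional row of (real) zeros on top. -/
def bar {d m : ℕ} (A : Matrix (Fin d) (Fin m) Trop) : Matrix (Fin (d + 1)) (Fin m) Trop :=
  Matrix.of (Matrix.vecCons (fun _ => ((0 : ℝ) : Trop)) A)

/-- `σ` is an optimal solution of the assignment problem with weights `C`: it is feasible (it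
uses no entry `-∞`) and has maximal weight. -/
def IsOptimal {k : ℕ} (C : Matrix (Fin k) (Fin k) Trop) (σ : Equiv.Perm (Fin k)) : Prop :=
  (∑ i, C i (σ i)) ≠ ⊥ ∧ ∀ τ : Equiv.Perm (Fin k), ∑ i, C i (τ i) ≤ ∑ i, C i (σ i)

/-- In every maximal square submatrix, all the optimal permutations have the same parity. -/
def IsSignGeneric {p n : ℕ} (B : Matrix (Fin p) (Fin n) Trop) : Prop :=
  ∀ k : ℕ, k = min p n → ∀ (r : Fin k ↪o Fin p) (c : Fin k ↪o Fin n)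
    (σ τ : Equiv.Perm (Fin k)), IsOptimal (B.submatrix r c) σ → IsOptimal (B.submatrix r c) τ →
      Equiv.Perm.sign σ = Equiv.Perm.sign τ

end DequantizedVolume

/-!
The volume of the convex hull of `m` points in `ℝ ^ d` is, up to constants depending only on `d`,
squeezed between the largest and the sum of the absolute values of the maximal minors of the
`(d + 1) × m` matrix of their homogeneous coordinates: each such minor is, up to sign and a
constant, the volume of a simplex spanned by `d + 1` of the points (`volConv_simplex`), and by
Carathéodory's theorem these simplices cover the polytope (`volConv_le_sum`).

For a lift of `A`, every Leibniz term of such a minor is a product of nonnegative functions, and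
its valuation is the corresponding tropical weight in `bar A` (`IsLift.hasVal_prod`). Let `qvol A`
be the largest of all these weights, over all injective choices of columns. Every Leibniz term has
valuation at most `qvol A`, which bounds the volume from above (`volConv_le_sum_prod`). Conversely,
take a minor with a term of weight `qvol A`, when this is not `-∞`. By sign-genericity all its
terms of that weight carry the same sign, so they cannot cancel; the remaining terms are negligible
(`IsLift.eventually_half_prod_le_abs_det`). So the volume of every lift has valuation `qvol A`
(`IsLift.hasVal_volConv`). Matrices of monomials `t ^ a` are lifts, hence the upper and lower
dequantized volumes are the supremum and the infimum of the singleton `{qvol A}`.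
-/

namespace DequantizedVolume

/-! ### Valuations of real functions -/

theorem Trop.toEReal_strictMono : StrictMono Trop.toEReal := by
  intro a b h
  induction a using WithBot.recBotCoe with
  | bot =>
    induction b using WithBot.recBotCoe with
    | bot => exact absurd h (lt_irrefl _)
    | coe b => exact EReal.bot_lt_coe b
  | coe a =>
    induction b using WithBot.recBotCoe with
    | bot => exact absurd h not_lt_bot
    | coe b => exact EReal.coe_lt_coe_iff.2 (WithBot.coe_lt_coe.1 h)

theorem Trop.toEReal_ne_top (a : Trop) : a.toEReal ≠ ⊤ := by
  induction a using WithBot.recBotCoe with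
  | bot => exact bot_ne_top
  | coe a => exact EReal.coe_ne_top a

theorem Trop.toEReal_add (a b : Trop) : (a + b).toEReal = a.toEReal + b.toEReal := by
  induction a using WithBot.recBotCoe with
  | bot => rw [WithBot.bot_add]; exact (EReal.bot_add _).symm
  | coe a =>
    induction b using WithBot.recBotCoe with
    | bot => rw [WithBot.add_bot]; exact (EReal.add_bot _).symm
    | coe b => exact EReal.coe_add a b

theorem coe_mul_log_eq_log_ofReal_rpow {t : ℝ} (ht : 1 < t) (b : ℝ) :
    (b : EReal) * (Real.log t : ℝ) = ENNReal.log (ENNReal.ofReal (t ^ b)) := by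
  have h0 : 0 < t := one_pos.trans ht
  rw [ENNReal.log_ofReal_of_pos (Real.rpow_pos_of_pos h0 b), Real.log_rpow h0, EReal.coe_mul]

theorem logAbs_div_log_lt_coe_iff {t : ℝ} (ht : 1 < t) (x b : ℝ) :
    logAbs x / ((Real.log t : ℝ) : EReal) < b ↔ |x| < t ^ b := by
  rw [EReal.div_lt_iff (EReal.coe_pos.2 (Real.log_pos ht)) (EReal.coe_ne_top _),
    coe_mul_log_eq_log_ofReal_rpow ht, logAbs, ENNReal.log_lt_log_iff,
    ENNReal.ofReal_lt_ofReal_iff (Real.rpow_pos_of_pos (one_pos.trans ht) b)]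

theorem coe_lt_logAbs_div_log_iff {t : ℝ} (ht : 1 < t) (x b : ℝ) :
    (b : EReal) < logAbs x / ((Real.log t : ℝ) : EReal) ↔ t ^ b < |x| := by
  rw [EReal.lt_div_iff (EReal.coe_pos.2 (Real.log_pos ht)) (EReal.coe_ne_top _),
    coe_mul_log_eq_log_ofReal_rpow ht, logAbs, ENNReal.log_lt_log_iff,
    ENNReal.ofReal_lt_ofReal_iff_of_nonneg (Real.rpow_nonneg (zero_le_one.trans ht.le) b)]

/-- The valuation of `f` is `a` exactly when `|f t|` is eventually squeezed between the powers of
`t` with exponents on either side of `a`. -/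
theorem hasVal_iff {f : ℝ → ℝ} {a : EReal} :
    HasVal f a ↔ (∀ b : ℝ, (b : EReal) < a → ∀ᶠ t in atTop, t ^ b < |f t|) ∧
      ∀ b : ℝ, a < b → ∀ᶠ t in atTop, |f t| < t ^ b := by
  rw [HasVal, tendsto_order]
  refine and_congr ⟨fun h b hb => ?_, fun h b hb => ?_⟩ ⟨fun h b hb => ?_, fun h b hb => ?_⟩
  · filter_upwards [h b hb, eventually_gt_atTop 1] with t h1 ht
    exact (coe_lt_logAbs_div_log_iff ht _ _).1 h1
  · obtain ⟨c, hbc, hca⟩ := EReal.lt_iff_exists_real_btwn.1 hb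
    filter_upwards [h c hca, eventually_gt_atTop 1] with t h1 ht
    exact hbc.trans ((coe_lt_logAbs_div_log_iff ht _ _).2 h1)
  · filter_upwards [h b hb, eventually_gt_atTop 1] with t h1 ht
    exact (logAbs_div_log_lt_coe_iff ht _ _).1 h1
  · obtain ⟨c, hac, hcb⟩ := EReal.lt_iff_exists_real_btwn.1 hb
    filter_upwards [h c hac, eventually_gt_atTop 1] with t h1 ht
    exact ((logAbs_div_log_lt_coe_iff ht _ _).2 h1).trans hcb

theorem hasVal_rpow (r : ℝ) : HasVal (fun t => t ^ r) r := by
  refine hasVal_iff.2 ⟨fun b hb => ?_, fun b hb => ?_⟩ <;>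
  · filter_upwards [eventually_gt_atTop 1] with t ht
    rw [abs_of_nonneg (Real.rpow_nonneg (zero_le_one.trans ht.le) r)]
    exact Real.rpow_lt_rpow_of_exponent_lt ht (EReal.coe_lt_coe_iff.1 hb)

theorem hasVal_zero : HasVal (fun _ => 0) ⊥ := by
  refine hasVal_iff.2 ⟨fun b hb => absurd hb not_lt_bot, fun b _ => ?_⟩
  filter_upwards [eventually_gt_atTop 0] with t ht
  simpa using Real.rpow_pos_of_pos ht b

theorem hasVal_one : HasVal (fun _ => 1) 0 := by
  simpa using hasVal_rpow 0

theorem HasVal.mul {f g : ℝ → ℝ} {a b : EReal} (hf : HasVal f a) (hg : HasVal g b)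
    (ha : a ≠ ⊤) (hb : b ≠ ⊤) : HasVal (fun t => f t * g t) (a + b) := by
  have h := Tendsto.comp (EReal.continuousAt_add (p := (a, b)) (.inl ha) (.inr hb))
    (hf.prodMk_nhds hg)
  refine h.congr' ?_
  filter_upwards [eventually_ge_atTop 1] with t ht
  rw [Function.comp_apply, logAbs, logAbs, logAbs, abs_mul, ENNReal.ofReal_mul (abs_nonneg _),
    ENNReal.log_mul_add, EReal.add_div_of_nonneg_right (EReal.coe_nonneg.2 (Real.log_nonneg ht))]

theorem HasVal.prod {ι : Type*} (s : Finset ι) {f : ι → ℝ → ℝ} {a : ι → Trop}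
    (h : ∀ i ∈ s, HasVal (f i) (a i).toEReal) :
    HasVal (fun t => ∏ i ∈ s, f i t) (∑ i ∈ s, a i).toEReal := by
  classical
  induction s using Finset.induction_on with
  | empty => simpa using! hasVal_one
  | insert i s hi ih =>
    simp only [Finset.prod_insert hi, Finset.sum_insert hi, Trop.toEReal_add]
    exact (h i (Finset.mem_insert_self i s)).mul
      (ih fun j hj => h j (Finset.mem_insert_of_mem hj))
      (Trop.toEReal_ne_top _) (Trop.toEReal_ne_top _)

/-- A function of smaller valuation is negligible against one of larger valuation. -/
theorem HasVal.eventually_mul_abs_lt {f g : ℝ → ℝ} {a b : EReal} (hf : HasVal f a)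
    (hg : HasVal g b) (hab : a < b) (M : ℝ) : ∀ᶠ t in atTop, M * |f t| < |g t| := by
  obtain ⟨r, har, hrb⟩ := EReal.lt_iff_exists_real_btwn.1 hab
  obtain ⟨s, hrs, hsb⟩ := EReal.lt_iff_exists_real_btwn.1 hrb
  have hrs' : 0 < s - r := sub_pos.2 (EReal.coe_lt_coe_iff.1 hrs)
  filter_upwards [(hasVal_iff.1 hf).2 r har, (hasVal_iff.1 hg).1 s hsb, eventually_gt_atTop 0,
    (tendsto_rpow_atTop hrs').eventually_ge_atTop |M|] with t h1 h2 ht h3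
  calc M * |f t| ≤ |M| * |f t| := by gcongr; exact le_abs_self M
    _ ≤ t ^ (s - r) * t ^ r := by gcongr
    _ = t ^ s := by rw [← Real.rpow_add ht, sub_add_cancel]
    _ < |g t| := h2

/-- The valuation is determined by bounds up to constant factors: from above by a finite
sum of functions of valuation at most `q` and, unless `q = -∞`, from below by one function of
valuation `q`. -/
theorem HasVal.of_bounds {ι : Type*} {v : ℝ → ℝ} {q : EReal} (s : Finset ι) {f : ι → ℝ → ℝ}
    {w : ι → EReal} {C : ℝ} (hf : ∀ i ∈ s, HasVal (f i) (w i)) (hw : ∀ i ∈ s, w i ≤ q)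
    (hupper : ∀ᶠ t in atTop, |v t| ≤ C * ∑ i ∈ s, |f i t|)
    (hlower : q ≠ ⊥ → ∃ g : ℝ → ℝ, HasVal g q ∧ ∃ c > 0, ∀ᶠ t in atTop, c * |g t| ≤ |v t|) :
    HasVal v q := by
  refine hasVal_iff.2 ⟨fun b hb => ?_, fun b hb => ?_⟩
  · obtain ⟨g, hg, c, hc, hcg⟩ := hlower (bot_le.trans_lt hb).ne'
    filter_upwards [hcg, (hasVal_rpow b).eventually_mul_abs_lt hg hb c⁻¹,
      eventually_gt_atTop 0] with t h1 h2 ht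
    rw [inv_mul_lt_iff₀ hc] at h2
    exact (le_abs_self _).trans_lt (h2.trans_le h1)
  · have h : ∀ i ∈ s, ∀ᶠ t : ℝ in atTop, C * (s.card + 1) * |f i t| < |t ^ b| := fun i hi =>
      (hf i hi).eventually_mul_abs_lt (hasVal_rpow b) ((hw i hi).trans_lt hb) _
    filter_upwards [hupper, (eventually_all_finset s).2 h, eventually_gt_atTop 0] with t h1 h2 ht
    have hpos := Real.rpow_pos_of_pos ht b
    have hs : (0 : ℝ) < s.card + 1 := by positivity
    calc |v t| ≤ ∑ i ∈ s, C * |f i t| := by rwa [← Finset.mul_sum]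
      _ ≤ ∑ i ∈ s, t ^ b / (s.card + 1) := by
        refine Finset.sum_le_sum fun i hi => ?_
        have := h2 i hi
        rw [abs_of_pos hpos] at this
        rw [le_div_iff₀ hs]
        linarith
      _ = s.card / (s.card + 1) * t ^ b := by
        rw [Finset.sum_const, nsmul_eq_mul]; ring
      _ < t ^ b := by
        refine mul_lt_of_lt_one_left hpos ?_
        rw [div_lt_one hs]
        exact lt_add_one _

/-! ### Volumes of convex hulls of finite point sets -/

/-- The matrix `B` bordered on top by a row of ones: the homogeneous coordinates of the
columns of `B`. -/
def homogenize {d n : ℕ} (B : Matrix (Fin d) (Fin n) ℝ) : Matrix (Fin (d + 1)) (Fin n) ℝ :=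
  Matrix.of (Matrix.vecCons (fun _ => 1) B)

@[simp] theorem homogenize_zero {d n : ℕ} (B : Matrix (Fin d) (Fin n) ℝ) (j : Fin n) :
    homogenize B 0 j = 1 := rfl

@[simp] theorem homogenize_succ {d n : ℕ} (B : Matrix (Fin d) (Fin n) ℝ) (i : Fin d)
    (j : Fin n) : homogenize B i.succ j = B i j := rfl

theorem homogenize_submatrix {d n k : ℕ} (B : Matrix (Fin d) (Fin n) ℝ) (c : Fin k → Fin n) :
    homogenize (B.submatrix id c) = (homogenize B).submatrix id c := by
  ext i j
  refine Fin.cases rfl (fun i => rfl) i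

/-- The matrix of edge vectors at the first vertex has the same determinant as the homogenized
matrix. -/
theorem det_homogenize {d : ℕ} (B : Matrix (Fin d) (Fin (d + 1)) ℝ) :
    (homogenize B).det = (Matrix.of fun i j : Fin d => B i j.succ - B i 0).det := by
  let N : Matrix (Fin (d + 1)) (Fin (d + 1)) ℝ :=
    Matrix.of fun j => Fin.cons (if j = 0 then 1 else 0) fun i =>
      if j = 0 then B i 0 else B i j - B i 0
  have h : (homogenize B).transpose.det = N.det := by
    refine Matrix.det_eq_of_forall_row_eq_smul_add_const (fun j => if j = 0 then 0 else 1) 0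
      (by simp) fun j i => ?_
    refine Fin.cases ?_ (fun i => ?_) i <;> by_cases hj : j = 0 <;> simp [N, hj]
  rw [← Matrix.det_transpose, h, Matrix.det_succ_column_zero, Fin.sum_univ_succ,
    ← Matrix.det_transpose (Matrix.of _)]
  simp only [N, Fin.succ_ne_zero, Matrix.of_apply, Fin.cons_zero, if_false, mul_zero, zero_mul,
    Finset.sum_const_zero, add_zero, if_true, Fin.val_zero, pow_zero, one_mul]
  congr 1

/-- The vertices of the standard simplex: the columns are the origin and the basis vectors. -/
def simplexVertices (d : ℕ) : Matrix (Fin d) (Fin (d + 1)) ℝ :=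
  Matrix.of fun i j => if j = i.succ then 1 else 0

theorem isCompact_convexHull_cols {d m : ℕ} (B : Matrix (Fin d) (Fin m) ℝ) :
    IsCompact (convexHull ℝ (Set.range fun (j : Fin m) (i : Fin d) => B i j)) :=
  (Set.finite_range _).isCompact_convexHull ℝ

/-- A simplex is the image of the standard one under an affine map whose linear part is the matrix
of edge vectors. -/
theorem volConv_simplex {d : ℕ} (B : Matrix (Fin d) (Fin (d + 1)) ℝ) :
    volConv B = |(homogenize B).det| * volConv (simplexVertices d) := by
  set E : Matrix (Fin d) (Fin d) ℝ := Matrix.of fun i j : Fin d => B i j.succ - B i 0 with hE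
  set p : Fin d → ℝ := fun i => B i 0 with hp
  let f : (Fin d → ℝ) →ᵃ[ℝ] (Fin d → ℝ) :=
    E.toLin'.toAffineMap + AffineMap.const ℝ (Fin d → ℝ) p
  have hf : ∀ x, f x = E.toLin' x + p := fun x => rfl
  have hrange : (Set.range fun (j : Fin (d + 1)) (i : Fin d) => B i j) =
      f '' Set.range fun (j : Fin (d + 1)) (i : Fin d) => simplexVertices d i j := by
    rw [← Set.range_comp]
    congr 1
    ext j i
    rw [Function.comp_apply, hf, Pi.add_apply, Matrix.toLin'_apply, Matrix.mulVec, dotProduct]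
    refine Fin.cases ?_ (fun j => ?_) j
    · simp [simplexVertices, hp, (Fin.succ_ne_zero _).symm]
    · simp [simplexVertices, hp, hE]
  have himage : ∀ S : Set (Fin d → ℝ), f '' S = (fun x => x + p) '' (E.toLin' '' S) := by
    intro S
    rw [Set.image_image]
    rfl
  unfold volConv
  rw [hrange, ← AffineMap.image_convexHull, himage, measureReal_def, measureReal_def,
    Set.image_add_right, measure_preimage_add_right, Measure.addHaar_image_linearMap,
    LinearMap.det_toLin', det_homogenize, ENNReal.toReal_mul,
    ENNReal.toReal_ofReal (abs_nonneg _)]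

theorem volConv_simplexVertices_pos (d : ℕ) : 0 < volConv (simplexVertices d) := by
  refine ENNReal.toReal_pos ?_ (isCompact_convexHull_cols _).measure_ne_top
  refine (Measure.measure_pos_of_nonempty_interior _ ?_).ne'
  rw [interior_convexHull_nonempty_iff_affineSpan_eq_top]
  set s := Set.range fun (j : Fin (d + 1)) (i : Fin d) => simplexVertices d i j
  have h0 : (0 : Fin d → ℝ) ∈ s := ⟨0, by ext i; simp [simplexVertices, (Fin.succ_ne_zero _).symm]⟩
  rw [AffineSubspace.affineSpan_eq_top_iff_vectorSpan_eq_top_of_nonempty ℝ _ _ ⟨0, h0⟩,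
    vectorSpan_eq_span_vsub_set_right ℝ h0, eq_top_iff, ← (Pi.basisFun ℝ (Fin d)).span_eq]
  refine Submodule.span_mono ?_
  rintro _ ⟨j, rfl⟩
  refine ⟨Pi.single j 1, ⟨j.succ, ?_⟩, by simp⟩
  ext i
  simp [simplexVertices, Pi.single_apply, eq_comm]

theorem volConv_nonneg {d m : ℕ} (B : Matrix (Fin d) (Fin m) ℝ) : 0 ≤ volConv B :=
  measureReal_nonneg

theorem volConv_submatrix_le {d m k : ℕ} (B : Matrix (Fin d) (Fin m) ℝ) (c : Fin k → Fin m) :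
    volConv (B.submatrix id c) ≤ volConv B :=
  measureReal_mono (convexHull_mono (Set.range_comp_subset_range c fun j i => B i j))
    (isCompact_convexHull_cols _).measure_ne_top

/-- By Carathéodory's theorem the convex hull of a finite set in dimension `d` is covered by the
(possibly degenerate) simplices on `d + 1` of its points. -/
theorem convexHull_cols_subset_iUnion {d m : ℕ} (B : Matrix (Fin d) (Fin m) ℝ) :
    convexHull ℝ (Set.range fun (j : Fin m) (i : Fin d) => B i j) ⊆
      ⋃ c : Fin (d + 1) → Fin m,
        convexHull ℝ (Set.range fun (j : Fin (d + 1)) (i : Fin d) => B.submatrix id c i j) := by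
  rw [convexHull_eq_union]
  refine Set.iUnion_subset fun t => Set.iUnion_subset fun hts => Set.iUnion_subset fun hind => ?_
  rcases t.eq_empty_or_nonempty with rfl | ht
  · simp
  have hcard : Fintype.card t ≤ Fintype.card (Fin (d + 1)) := by
    refine hind.card_le_finrank_succ.trans ?_
    rw [Fintype.card_fin]
    gcongr
    exact (Submodule.finrank_le _).trans (by simp)
  have := ht.to_subtype
  obtain ⟨e⟩ := Function.Embedding.nonempty_of_card_le hcard
  choose g hg using fun x : t => hts x.2
  refine Set.subset_iUnion_of_subset (g ∘ Function.invFun e) (convexHull_mono fun x hx => ?_)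
  refine ⟨e ⟨x, hx⟩, ?_⟩
  simpa [Function.leftInverse_invFun e.injective _] using! hg ⟨x, hx⟩

theorem volConv_le_sum {d m : ℕ} (B : Matrix (Fin d) (Fin m) ℝ) :
    volConv B ≤ ∑ c : Fin (d + 1) → Fin m, volConv (B.submatrix id c) := by
  refine (measureReal_mono (convexHull_cols_subset_iUnion B) ?_).trans
    (measureReal_iUnion_fintype_le _)
  exact (isCompact_iUnion fun c => isCompact_convexHull_cols (B.submatrix id c)).measure_ne_top

/-! ### Determinants of lifts -/

section

variable {K : Subring (Germ (atTop : Filter ℝ) ℝ)} {d m : ℕ}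
  {F : ℝ → Matrix (Fin d) (Fin m) ℝ} {A : Matrix (Fin d) (Fin m) Trop}

theorem IsLift.hasVal_homogenize (hF : IsLift K F A) (i : Fin (d + 1)) (j : Fin m) :
    HasVal (fun t => homogenize (F t) i j) (bar A i j).toEReal := by
  refine Fin.cases ?_ (fun i => ?_) i
  · exact hasVal_one
  · exact hF.hasVal i j

theorem IsLift.eventually_homogenize_nonneg (hF : IsLift K F A) :
    ∀ᶠ t in atTop, ∀ i j, 0 ≤ homogenize (F t) i j := by
  have h : ∀ᶠ t in atTop, ∀ i j, 0 ≤ F t i j :=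
    eventually_all.2 fun i => eventually_all.2 fun j => hF.nonneg i j
  filter_upwards [h] with t ht i j
  refine Fin.cases ?_ (fun i => ?_) i
  · exact zero_le_one
  · exact ht i j

theorem IsLift.hasVal_prod (hF : IsLift K F A) (c : Fin (d + 1) → Fin m) :
    HasVal (fun t => ∏ i, homogenize (F t) i (c i)) (∑ i, bar A i (c i)).toEReal :=
  HasVal.prod _ fun i _ => hF.hasVal_homogenize i (c i)

/-- The Leibniz formula, indexed by the permutations of the columns. -/
theorem det_homogenize_submatrix (B : Matrix (Fin d) (Fin m) ℝ) (c : Fin (d + 1) → Fin m) :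
    (homogenize (B.submatrix id c)).det =
      ∑ σ : Equiv.Perm (Fin (d + 1)),
        (Equiv.Perm.sign σ : ℝ) * ∏ i, homogenize B i (c (σ i)) := by
  rw [homogenize_submatrix, ← Matrix.det_transpose, Matrix.det_apply']
  rfl

theorem abs_sign {n : ℕ} (σ : Equiv.Perm (Fin n)) : |((Equiv.Perm.sign σ : ℤ) : ℝ)| = 1 := by
  rcases Int.units_eq_one_or (Equiv.Perm.sign σ) with h | h <;> simp [h]

/-- Up to a constant, the volume is at most the sum of the absolute values of the Leibniz terms of
the maximal minors of the homogenized matrix. Only injective choices of columns contribute, since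
a minor with a repeated column vanishes. -/
theorem volConv_le_sum_prod (B : Matrix (Fin d) (Fin m) ℝ) :
    volConv B ≤ volConv (simplexVertices d) * Fintype.card (Equiv.Perm (Fin (d + 1))) *
      ∑ c : Fin (d + 1) → Fin m with Function.Injective c, |∏ i, homogenize B i (c i)| := by
  set T : (Fin (d + 1) → Fin m) → ℝ := fun c => |∏ i, homogenize B i (c i)|
  have hzero : ∀ c : Fin (d + 1) → Fin m, ¬ Function.Injective c →
      volConv (B.submatrix id c) = 0 := by
    intro c hc
    obtain ⟨i, j, hij, hne⟩ := Function.not_injective_iff.1 hc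
    rw [volConv_simplex, homogenize_submatrix, Matrix.det_zero_of_column_eq hne, abs_zero,
      zero_mul]
    intro k
    simp [hij]
  have hle : ∀ c : Fin (d + 1) → Fin m, volConv (B.submatrix id c) ≤
      volConv (simplexVertices d) * ∑ σ : Equiv.Perm (Fin (d + 1)), T (c ∘ σ) := by
    intro c
    rw [volConv_simplex, mul_comm, det_homogenize_submatrix]
    refine mul_le_mul_of_nonneg_left ((Finset.abs_sum_le_sum_abs _ _).trans_eq ?_)
      (volConv_simplexVertices_pos d).le
    refine Finset.sum_congr rfl fun σ _ => ?_
    rw [abs_mul, abs_sign, one_mul]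
    rfl
  calc volConv B ≤ ∑ c : Fin (d + 1) → Fin m, volConv (B.submatrix id c) := volConv_le_sum B
    _ = ∑ c : Fin (d + 1) → Fin m with Function.Injective c, volConv (B.submatrix id c) := by
      refine (Finset.sum_filter_of_ne fun c _ hc => ?_).symm
      by_contra h
      exact hc (hzero c h)
    _ ≤ ∑ c : Fin (d + 1) → Fin m with Function.Injective c,
        volConv (simplexVertices d) * ∑ σ : Equiv.Perm (Fin (d + 1)), T (c ∘ σ) :=
      Finset.sum_le_sum fun c _ => hle c
    _ = volConv (simplexVertices d) * ∑ σ : Equiv.Perm (Fin (d + 1)),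
        ∑ c : Fin (d + 1) → Fin m with Function.Injective c, T (c ∘ σ) := by
      rw [← Finset.mul_sum, Finset.sum_comm]
    _ = volConv (simplexVertices d) * ∑ σ : Equiv.Perm (Fin (d + 1)),
        ∑ c : Fin (d + 1) → Fin m with Function.Injective c, T c := by
      congr 1
      refine Finset.sum_congr rfl fun σ _ => ?_
      refine Finset.sum_equiv (σ.symm.arrowCongr (Equiv.refl (Fin m))) (fun c => ?_) fun c _ => ?_
      · simp only [Finset.mem_filter, Finset.mem_univ, true_and]
        exact (σ.injective_comp c).symm
      · rfl
    _ = _ := by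
      rw [Finset.sum_const, Finset.card_univ, nsmul_eq_mul, mul_assoc]

/-- Among the Leibniz terms of a maximal minor, those of optimal permutations have the same sign by
sign-genericity, so they cannot cancel, and the other terms have smaller valuation. Hence the minor
is at least half of a single optimal term. -/
theorem IsLift.eventually_half_prod_le_abs_det (hF : IsLift K F A)
    (hA : IsSignGeneric (bar A)) (c : Fin (d + 1) ↪o Fin m) (σ : Equiv.Perm (Fin (d + 1)))
    (hσ : IsOptimal ((bar A).submatrix id c) σ) :
    ∀ᶠ t in atTop, 2⁻¹ * |∏ i, homogenize (F t) i (c (σ i))| ≤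
      |(homogenize ((F t).submatrix id c)).det| := by
  have hdm : d + 1 ≤ m := by simpa using Fintype.card_le_of_embedding c.toEmbedding
  set N : ℝ := (Fintype.card (Equiv.Perm (Fin (d + 1))) : ℝ)
  have hN : 0 < N := Nat.cast_pos.2 Fintype.card_pos
  have hsmall : ∀ τ : Equiv.Perm (Fin (d + 1)), ¬ IsOptimal ((bar A).submatrix id c) τ →
      ∀ᶠ t in atTop, 2 * N * |∏ i, homogenize (F t) i (c (τ i))| <
        |∏ i, homogenize (F t) i (c (σ i))| := by
    intro τ hτ
    refine (hF.hasVal_prod (c ∘ τ)).eventually_mul_abs_lt (hF.hasVal_prod (c ∘ σ))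
      (Trop.toEReal_strictMono ((hσ.2 τ).lt_of_ne fun h => hτ ⟨?_, fun ρ => ?_⟩)) _
    · rw [h]; exact hσ.1
    · rw [h]; exact hσ.2 ρ
  filter_upwards [hF.eventually_homogenize_nonneg, eventually_all.2 fun τ =>
    eventually_all.2 (hsmall τ)] with t hnonneg hlt
  set P : Equiv.Perm (Fin (d + 1)) → ℝ := fun τ => ∏ i, homogenize (F t) i (c (τ i))
  have hP : ∀ τ, 0 ≤ P τ := fun τ => Finset.prod_nonneg fun i _ => hnonneg _ _
  set s : ℝ := ((Equiv.Perm.sign σ : ℤ) : ℝ) with hs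
  have hss : s * s = 1 := by rw [hs]; exact_mod_cast Int.units_coe_mul_self _
  -- every term other than the one at `σ` is nonnegative after multiplication by the sign of `σ`,
  -- or else small
  have hterm : ∀ τ ∈ Finset.univ.erase σ,
      -(P σ / (2 * N)) ≤ s * (((Equiv.Perm.sign τ : ℤ) : ℝ) * P τ) := by
    intro τ _
    by_cases hτ : IsOptimal ((bar A).submatrix id c) τ
    · have hsign := hA (d + 1) (by simpa using hdm) (RelEmbedding.refl _) c σ τ hσ hτ
      rw [← hsign, ← hs, ← mul_assoc, hss, one_mul]
      exact (neg_nonpos.2 (by have := hP σ; positivity)).trans (hP τ)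
    · have h := hlt τ hτ
      change 2 * N * |P τ| < |P σ| at h
      rw [abs_of_nonneg (hP σ)] at h
      have h1 : |s * (((Equiv.Perm.sign τ : ℤ) : ℝ) * P τ)| = |P τ| := by
        rw [abs_mul, abs_mul, abs_sign, abs_sign, one_mul, one_mul]
      refine (neg_le_neg ?_).trans (neg_abs_le _)
      rw [h1, le_div_iff₀ (by positivity)]
      linarith
  calc 2⁻¹ * |P σ| = P σ - N * (P σ / (2 * N)) := by
        rw [abs_of_nonneg (hP σ)]; field_simp; ring
    _ ≤ P σ + ∑ τ ∈ Finset.univ.erase σ, s * (((Equiv.Perm.sign τ : ℤ) : ℝ) * P τ) := by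
      have h1 := Finset.sum_le_sum hterm
      rw [Finset.sum_const, nsmul_eq_mul, Finset.card_erase_of_mem (Finset.mem_univ _),
        Finset.card_univ] at h1
      have h2 : ((Fintype.card (Equiv.Perm (Fin (d + 1))) - 1 : ℕ) : ℝ) * (P σ / (2 * N)) ≤
          N * (P σ / (2 * N)) :=
        mul_le_mul_of_nonneg_right (Nat.cast_le.2 (Nat.sub_le _ _))
          (by have := hP σ; positivity)
      linarith
    _ = s * (homogenize ((F t).submatrix id c)).det := by
      rw [det_homogenize_submatrix, Finset.mul_sum,
        ← Finset.add_sum_erase _ _ (Finset.mem_univ σ)]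
      congr 1
      change P σ = s * (s * P σ)
      rw [← mul_assoc, hss, one_mul]
    _ ≤ |s * (homogenize ((F t).submatrix id c)).det| := le_abs_self _
    _ = |(homogenize ((F t).submatrix id c)).det| := by rw [abs_mul, abs_sign, one_mul]

/-- An injection from `Fin k` is an increasing one precomposed with a permutation. -/
theorem exists_orderEmbedding_comp_perm {k n : ℕ} {c : Fin k → Fin n}
    (hc : Function.Injective c) :
    ∃ (e : Fin k ↪o Fin n) (σ : Equiv.Perm (Fin k)), ∀ i, c i = e (σ i) := by
  have hcard : (Finset.univ.image c).card = k := by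
    rw [Finset.card_image_of_injective _ hc, Finset.card_fin]
  let o := (Finset.univ.image c).orderIsoOfFin hcard
  let σ : Fin k → Fin k := fun i => o.symm ⟨c i, Finset.mem_image_of_mem c (Finset.mem_univ i)⟩
  have hσ : Function.Injective σ := fun i j h => hc (Subtype.ext_iff.1 (o.symm.injective h))
  refine ⟨(Finset.univ.image c).orderEmbOfFin hcard,
    Equiv.ofBijective σ (Finite.injective_iff_bijective.1 hσ), fun i => ?_⟩
  change c i = (o (o.symm _) : Fin n)
  rw [OrderIso.apply_symm_apply]

/-! ### The dequantized volume -/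

/-- The dequantized volume: the maximal tropical weight of a choice of pairwise distinct columns of
`bar A`, one for each row. It is `-∞` if there are fewer than `d + 1` columns. -/
noncomputable def qvol (A : Matrix (Fin d) (Fin m) Trop) : Trop :=
  Finset.sup {c : Fin (d + 1) → Fin m | Function.Injective c} fun c => ∑ i, bar A i (c i)

theorem sum_le_qvol (A : Matrix (Fin d) (Fin m) Trop) {c : Fin (d + 1) → Fin m}
    (hc : Function.Injective c) : ∑ i, bar A i (c i) ≤ qvol A :=
  Finset.le_sup (f := fun c : Fin (d + 1) → Fin m => ∑ i, bar A i (c i)) (by simpa using hc)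

theorem exists_sum_eq_qvol (h : qvol A ≠ ⊥) :
    ∃ c : Fin (d + 1) → Fin m, Function.Injective c ∧ ∑ i, bar A i (c i) = qvol A := by
  have hne : ({c : Fin (d + 1) → Fin m | Function.Injective c} : Finset _).Nonempty := by
    by_contra hemp
    rw [Finset.not_nonempty_iff_eq_empty] at hemp
    exact h (by rw [qvol, hemp, Finset.sup_empty])
  obtain ⟨c, hc, heq⟩ := Finset.exists_mem_eq_sup _ hne
    fun c : Fin (d + 1) → Fin m => ∑ i, bar A i (c i)
  exact ⟨c, by simpa using hc, heq.symm⟩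

theorem IsLift.hasVal_volConv (hF : IsLift K F A) (hA : IsSignGeneric (bar A)) :
    HasVal (fun t => volConv (F t)) (qvol A).toEReal := by
  refine HasVal.of_bounds
    (C := volConv (simplexVertices d) * Fintype.card (Equiv.Perm (Fin (d + 1))))
    {c : Fin (d + 1) → Fin m | Function.Injective c}
    (fun c _ => hF.hasVal_prod c)
    (fun c hc => Trop.toEReal_strictMono.monotone (sum_le_qvol A (by simpa using hc)))
    (Eventually.of_forall fun t => ?_) fun hq => ?_
  · rw [abs_of_nonneg (volConv_nonneg _)]
    exact volConv_le_sum_prod (F t)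
  · have hbot : qvol A ≠ ⊥ := fun h => hq (by rw [h]; rfl)
    obtain ⟨c, hc, hcq⟩ := exists_sum_eq_qvol hbot
    obtain ⟨e, σ, hceσ⟩ := exists_orderEmbedding_comp_perm hc
    have hopt : IsOptimal ((bar A).submatrix id e) σ := by
      have hsum : ∑ i, (bar A).submatrix id e i (σ i) = qvol A := by
        simpa only [hceσ] using! hcq
      refine ⟨hsum ▸ hbot, fun τ => ?_⟩
      rw [hsum]
      exact sum_le_qvol A (e.injective.comp τ.injective)
    refine ⟨fun t => ∏ i, homogenize (F t) i (c i), hcq ▸ hF.hasVal_prod c,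
      2⁻¹ * volConv (simplexVertices d), mul_pos (by norm_num) (volConv_simplexVertices_pos d), ?_⟩
    filter_upwards [hF.eventually_half_prod_le_abs_det hA e σ hopt] with t ht
    rw [abs_of_nonneg (volConv_nonneg _)]
    simp only [hceσ]
    calc 2⁻¹ * volConv (simplexVertices d) * |∏ i, homogenize (F t) i (e (σ i))|
        = 2⁻¹ * |∏ i, homogenize (F t) i (e (σ i))| * volConv (simplexVertices d) := by ring
      _ ≤ |(homogenize ((F t).submatrix id e)).det| * volConv (simplexVertices d) :=
        mul_le_mul_of_nonneg_right ht (volConv_simplexVertices_pos d).le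
      _ = volConv ((F t).submatrix id e) := (volConv_simplex _).symm
      _ ≤ volConv (F t) := volConv_submatrix_le _ _

end

/-- The matrix of monomials `t ^ a i j`, with `0` for the entries `-∞`, is a lift. -/
theorem exists_isLift {K : Subring (Germ (atTop : Filter ℝ) ℝ)}
    (hK : ∀ r : ℝ, ((fun t : ℝ => t ^ r : ℝ → ℝ) : Germ (atTop : Filter ℝ) ℝ) ∈ K)
    {d m : ℕ} (A : Matrix (Fin d) (Fin m) Trop) :
    ∃ F : ℝ → Matrix (Fin d) (Fin m) ℝ, IsLift K F A := by
  have h : ∀ a : Trop, ∃ f : ℝ → ℝ, (f : Germ (atTop : Filter ℝ) ℝ) ∈ K ∧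
      (∀ᶠ t in atTop, 0 ≤ f t) ∧ HasVal f a.toEReal := by
    intro a
    induction a using WithBot.recBotCoe with
    | bot => exact ⟨fun _ => 0, K.zero_mem, Eventually.of_forall fun _ => le_rfl, hasVal_zero⟩
    | coe r =>
      exact ⟨fun t => t ^ r, hK r,
        (eventually_ge_atTop 0).mono fun t ht => Real.rpow_nonneg ht r, hasVal_rpow r⟩
  choose f hmem hnonneg hval using h
  exact ⟨fun t => Matrix.of fun i j => f (A i j) t,
    ⟨fun i j => hmem _, fun i j => hnonneg _, fun i j => hval _⟩⟩

theorem liftVolumeVals_eq {K : Subring (Germ (atTop : Filter ℝ) ℝ)}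
    (hK : ∀ r : ℝ, ((fun t : ℝ => t ^ r : ℝ → ℝ) : Germ (atTop : Filter ℝ) ℝ) ∈ K)
    {d m : ℕ} {A : Matrix (Fin d) (Fin m) Trop} (hA : IsSignGeneric (bar A)) :
    liftVolumeVals K A = {(qvol A).toEReal} := by
  obtain ⟨F, hF⟩ := exists_isLift hK A
  refine Set.eq_singleton_iff_unique_mem.2 ⟨⟨F, hF, hF.hasVal_volConv hA⟩, ?_⟩
  rintro a ⟨G, hG, ha⟩
  exact tendsto_nhds_unique ha (hG.hasVal_volConv hA)

end DequantizedVolume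

theorem mainTheorem4 (L : FirstOrder.Language.{u, v}) [L.Structure ℝ]
    (hL : DequantizedVolume.IsOMinimal L)
    (hpb : DequantizedVolume.IsPolynomiallyBounded L)
    (K : Subring (Germ (atTop : Filter ℝ) ℝ))
    (hK : DequantizedVolume.IsDefinableHardyField L K)
    (d m : ℕ) (A : Matrix (Fin d) (Fin m) DequantizedVolume.Trop)
    (hA : DequantizedVolume.IsSignGeneric (DequantizedVolume.bar A)) :
    ∃ q : DequantizedVolume.Trop,
      DequantizedVolume.qvolUpper K A = q.toEReal ∧
      DequantizedVolume.qvolLower K A = q.toEReal ∧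
      ∀ F : ℝ → Matrix (Fin d) (Fin m) ℝ, DequantizedVolume.IsLift K F A →
        Tendsto (fun t : ℝ =>
            DequantizedVolume.logAbs (DequantizedVolume.volConv (F t)) /
              ((Real.log t : ℝ) : EReal))
          atTop (𝓝 q.toEReal) := by
  refine ⟨DequantizedVolume.qvol A, ?_, ?_, fun F hF => hF.hasVal_volConv hA⟩
  · rw [DequantizedVolume.qvolUpper, DequantizedVolume.liftVolumeVals_eq hK.rpow_mem hA,
      sSup_singleton]
  · rw [DequantizedVolume.qvolLower, DequantizedVolume.liftVolumeVals_eq hK.rpow_mem hA,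
      sInf_singleton]
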